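/- Let $M$ be a smooth manifold of dimension $2n+1$ with a Riemannian metric $g$ and Levi-Civita connection $\nabla$, and let $\phi$ be a smooth $(1,1)$-tensor field, $\xi$ a smooth vector field and $\eta$ a smooth 1-form on $M$ such that $$\phi^2=\mathrm{id}-\eta\otimes\xi,\qquad \eta(\xi)=1,\qquad g(x,\xi)=\eta(x),\qquad g(\phi x,\phi y)=g(x,y)-\eta(x)\eta(y),$$ and such that on $H=\ker\eta$ the eigenvalues $+1$ and $-1$ of $\phi$ both have multiplicity $n$ (an almost paracontact paracomplex Riemannian manifold). Put $F(x,y,z)=g((\nabla_x\phi)y,z)$ and assume that $(M,\phi,\xi,\eta,g)$ is para-Sasaki-like, i.e. for all $X,Y,Z\in H$ $$F(X,Y,Z)=F(\xi,Y,Z)=F(\xi,\xi,Z)=0,\qquad F(X,Y,\xi)=-g(X,Y).$$ Let $R(x,y)z=\nabla_x\nabla_yz-\nabla_y\nabla_xz-\nabla_{[x,y]}z$, $R(x,y,z,w)=g(R(x,y)z,w)$ and $\mathrm{Ric}(x,y)=\sum_{i=0}^{2n}R(e_i,x,y,e_i)$ for an arbitrary orthonormal basis $\{e_0,\dots,e_{2n}\}$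 of the tangent space. Then for all smooth vector fields $x,y,z,w$ on $M$ $$\begin{aligned}R(x,y,\phi z,w)-R(x,y,z,\phi w)=&-\{g(y,z)-2\eta(y)\eta(z)\}g(x,\phi w)-\{g(y,w)-2\eta(y)\eta(w)\}g(x,\phi z)\\&+\{g(x,z)-2\eta(x)\eta(z)\}g(y,\phi w)+\{g(x,w)-2\eta(x)\eta(w)\}g(y,\phi z).\end{aligned}$$ In particular, for all smooth vector fields $x,y$ and all smooth horizontal vector fields $X$ (that is, $\eta(X)=0$), $$R(x,y)\xi=-\eta(y)x+\eta(x)y,$$ $$[X,\xi]\in H,\qquad \nabla_\xi X=\phi X-[X,\xi]\in H,$$ $$R(\xi,X)\xi=X,\qquad \mathrm{Ric}(y,\xi)=-2n\,\eta(y),\qquad \mathrm{Ric}(\xi,\xi)=-2n.$$ -/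

import Mathlib

open Bundle VectorField Module
open scoped Manifold ContDiff

set_option linter.unusedSectionVars false

noncomputable section

namespace ParaSasaki

/-! ### The Levi-Civita connection -/

variable {E : Type*} [NormedAddCommGroup E] [NormedSpace ℝ E] [FiniteDimensional ℝ E]
  {H : Type*} [TopologicalSpace H] (I : ModelWithCorners ℝ E H)
  {M : Type*} [TopologicalSpace M] [ChartedSpace H M] [IsManifold I ∞ M]
  [RiemannianBundle (fun x : M ↦ TangentSpace I x)]
  [IsContMDiffRiemannianBundle I ∞ E (fun x : M ↦ TangentSpace I x)]

/-- `g(X, Y)` as a function on `M`. -/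
def metricFun (X Y : Π x : M, TangentSpace I x) : M → ℝ := fun x ↦ inner ℝ (X x) (Y x)

/-- The right-hand side of the Koszul formula for `g(∇_X Y, Z)`:
`(X g(Y,Z) + Y g(Z,X) - Z g(X,Y) + g([X,Y],Z) + g([Z,X],Y) + g([Z,Y],X)) / 2`. -/
def koszul (X Y Z : Π x : M, TangentSpace I x) (x : M) : ℝ :=
  (1 / 2) * (mvfderiv I (metricFun I Y Z) x (X x) + mvfderiv I (metricFun I Z X) x (Y x)
    - mvfderiv I (metricFun I X Y) x (Z x)
    + metricFun I (mlieBracket I X Y) Z x + metricFun I (mlieBracket I Z X) Y x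
    + metricFun I (mlieBracket I Z Y) X x)

variable {I}
variable {X X' Y Y' Z : Π x : M, TangentSpace I x} {x : M} {f : M → ℝ}

lemma mdiff_metricFun (hX : MDiffAt (T% X) x) (hY : MDiffAt (T% Y) x) :
    MDiffAt (metricFun I X Y) x := by
  exact MDifferentiableAt.inner_bundle (b := id) hX hY

lemma metricFun_comm : metricFun I X Y = metricFun I Y X := by
  funext x; exact real_inner_comm _ _

lemma metricFun_add_left : metricFun I (X + X') Y = metricFun I X Y + metricFun I X' Y := by
  funext x; exact inner_add_left _ _ _

lemma metricFun_smul_left : metricFun I (f • X) Y = f * metricFun I X Y := by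
  funext x; exact real_inner_smul_left _ _ _

lemma mvfderiv_metricFun_add_left (hX : MDiffAt (T% X) x) (hX' : MDiffAt (T% X') x)
    (hY : MDiffAt (T% Y) x) : mvfderiv I (metricFun I (X + X') Y) x =
    mvfderiv I (metricFun I X Y) x + mvfderiv I (metricFun I X' Y) x := by
  rw [metricFun_add_left]
  exact mvfderiv_add (mdiff_metricFun hX hY) (mdiff_metricFun hX' hY)

lemma mvfderiv_metricFun_smul_left (hf : MDiffAt f x) (hX : MDiffAt (T% X) x)
    (hY : MDiffAt (T% Y) x) : mvfderiv I (metricFun I (f • X) Y) x =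
    f x • mvfderiv I (metricFun I X Y) x + metricFun I X Y x • mvfderiv I f x := by
  rw [metricFun_smul_left]
  exact mvfderiv_mul hf (mdiff_metricFun hX hY)


lemma mf_bracket_smul_left (hf : MDiffAt f x) (hX : MDiffAt (T% X) x) :
    metricFun I (mlieBracket I (f • X) Y) Z x =
      f x * metricFun I (mlieBracket I X Y) Z x - mvfderiv I f x (Y x) * metricFun I X Z x := by
  have : CompleteSpace E := FiniteDimensional.complete ℝ E
  simp only [metricFun, mlieBracket_smul_left hf hX, inner_add_left, real_inner_smul_left]
  ring

lemma mf_bracket_smul_right (hf : MDiffAt f x) (hX : MDiffAt (T% X) x) :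
    metricFun I (mlieBracket I Y (f • X)) Z x =
      f x * metricFun I (mlieBracket I Y X) Z x + mvfderiv I f x (Y x) * metricFun I X Z x := by
  have : CompleteSpace E := FiniteDimensional.complete ℝ E
  simp only [metricFun, mlieBracket_smul_right hf hX, inner_add_left, real_inner_smul_left]
  ring

lemma mf_bracket_add_left (hX : MDiffAt (T% X) x) (hX' : MDiffAt (T% X') x) :
    metricFun I (mlieBracket I (X + X') Y) Z x =
      metricFun I (mlieBracket I X Y) Z x + metricFun I (mlieBracket I X' Y) Z x := by
  have : CompleteSpace E := FiniteDimensional.complete ℝ E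
  simp only [metricFun, mlieBracket_add_left hX hX', inner_add_left]

lemma mf_bracket_add_right (hX : MDiffAt (T% X) x) (hX' : MDiffAt (T% X') x) :
    metricFun I (mlieBracket I Y (X + X')) Z x =
      metricFun I (mlieBracket I Y X) Z x + metricFun I (mlieBracket I Y X') Z x := by
  have : CompleteSpace E := FiniteDimensional.complete ℝ E
  simp only [metricFun, mlieBracket_add_right hX hX', inner_add_left]

lemma mf_bracket_swap :
    metricFun I (mlieBracket I X Y) Z x = - metricFun I (mlieBracket I Y X) Z x := by
  simp only [metricFun]
  rw [mlieBracket_swap_apply, inner_neg_left]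

/-- The Koszul expression is tensorial in its first argument. -/
lemma koszul_tensorial_left (hY : MDiffAt (T% Y) x) (hZ : MDiffAt (T% Z) x) :
    TensorialAt I E (fun X ↦ koszul I X Y Z x) x where
  smul {f X} hf hX := by
    simp only [koszul, metricFun_comm (X := Z) (Y := f • X),
      mvfderiv_metricFun_smul_left hf hX hZ, mvfderiv_metricFun_smul_left hf hX hY,
      mf_bracket_smul_left hf hX, mf_bracket_smul_right hf hX,
      metricFun_comm (X := mlieBracket I Z Y) (Y := f • X)]
    rw [metricFun_smul_left, metricFun_comm (X := Z) (Y := X),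
      metricFun_comm (X := mlieBracket I Z Y)]
    simp
    ring
  add {X X'} hX hX' := by
    simp only [koszul, metricFun_comm (X := Z) (Y := X + X'),
      mvfderiv_metricFun_add_left hX hX' hZ, mvfderiv_metricFun_add_left hX hX' hY,
      mf_bracket_add_left hX hX', mf_bracket_add_right hX hX',
      metricFun_comm (X := mlieBracket I Z Y) (Y := X + X')]
    rw [metricFun_add_left, metricFun_comm (X := Z) (Y := X), metricFun_comm (X := Z) (Y := X'),
      metricFun_comm (X := mlieBracket I Z Y) (Y := X),
      metricFun_comm (X := mlieBracket I Z Y) (Y := X')]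
    simp
    ring

/-- The Koszul expression is tensorial in its third argument. -/
lemma koszul_tensorial_right (hX : MDiffAt (T% X) x) (hY : MDiffAt (T% Y) x) :
    TensorialAt I E (fun Z ↦ koszul I X Y Z x) x where
  smul {f Z} hf hZ := by
    simp only [koszul, metricFun_comm (X := Y) (Y := f • Z),
      mvfderiv_metricFun_smul_left hf hZ hX, mvfderiv_metricFun_smul_left hf hZ hY,
      mf_bracket_smul_left hf hZ, metricFun_comm (X := mlieBracket I X Y) (Y := f • Z)]
    rw [metricFun_smul_left, metricFun_comm (X := Y) (Y := Z),
      metricFun_comm (X := mlieBracket I X Y)]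
    simp
    ring
  add {Z Z'} hZ hZ' := by
    simp only [koszul, metricFun_comm (X := Y) (Y := Z + Z'),
      mvfderiv_metricFun_add_left hZ hZ' hX, mvfderiv_metricFun_add_left hZ hZ' hY,
      mf_bracket_add_left hZ hZ', metricFun_comm (X := mlieBracket I X Y) (Y := Z + Z')]
    rw [metricFun_add_left, metricFun_comm (X := Y) (Y := Z), metricFun_comm (X := Y) (Y := Z'),
      metricFun_comm (X := mlieBracket I X Y) (Y := Z),
      metricFun_comm (X := mlieBracket I X Y) (Y := Z')]
    simp
    ring

lemma koszul_add (hX : MDiffAt (T% X) x) (hY : MDiffAt (T% Y) x) (hY' : MDiffAt (T% Y') x)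
    (hZ : MDiffAt (T% Z) x) :
    koszul I X (Y + Y') Z x = koszul I X Y Z x + koszul I X Y' Z x := by
  simp only [koszul, metricFun_comm (X := X) (Y := Y + Y'),
    mvfderiv_metricFun_add_left hY hY' hX, mvfderiv_metricFun_add_left hY hY' hZ,
    mf_bracket_add_right hY hY', metricFun_comm (X := mlieBracket I Z X) (Y := Y + Y')]
  rw [metricFun_add_left, metricFun_comm (X := X) (Y := Y), metricFun_comm (X := X) (Y := Y'),
    metricFun_comm (X := mlieBracket I Z X) (Y := Y),
    metricFun_comm (X := mlieBracket I Z X) (Y := Y')]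
  simp
  ring

lemma koszul_smul (hf : MDiffAt f x) (hX : MDiffAt (T% X) x) (hY : MDiffAt (T% Y) x)
    (hZ : MDiffAt (T% Z) x) :
    koszul I X (f • Y) Z x =
      f x * koszul I X Y Z x + mvfderiv I f x (X x) * inner ℝ (Y x) (Z x) := by
  change _ = _ + _ * metricFun I Y Z x
  simp only [koszul, metricFun_comm (X := X) (Y := f • Y),
    mvfderiv_metricFun_smul_left hf hY hX, mvfderiv_metricFun_smul_left hf hY hZ,
    mf_bracket_smul_right hf hY, metricFun_comm (X := mlieBracket I Z X) (Y := f • Y)]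
  rw [metricFun_smul_left, metricFun_comm (X := X) (Y := Y),
    metricFun_comm (X := mlieBracket I Z X)]
  simp
  ring

variable (I) in
/-- The bilinear form `(u, v) ↦ g(∇_u Y, v)` at `x`, given by the Koszul formula. -/
def koszulForm (Y : Π x : M, TangentSpace I x) (x : M) (hY : MDiffAt (T% Y) x) :
    TangentSpace I x →L[ℝ] TangentSpace I x →L[ℝ] ℝ :=
  TensorialAt.mkHom₂ (I := I) (F := E) (F' := E) (fun X Z ↦ koszul I X Y Z x) x
    (fun _ hZ ↦ koszul_tensorial_left hY hZ) (fun _ hX ↦ koszul_tensorial_right hX hY)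

lemma koszulForm_apply (hX : MDiffAt (T% X) x) (hY : MDiffAt (T% Y) x) (hZ : MDiffAt (T% Z) x) :
    koszulForm I Y x hY (X x) (Z x) = koszul I X Y Z x :=
  TensorialAt.mkHom₂_apply _ _ hX hZ

lemma finiteDimensional_tangentSpace (x : M) : FiniteDimensional ℝ (TangentSpace I x) :=
  VectorBundle.finiteDimensional ℝ E (fun x : M ↦ TangentSpace I x) x

open scoped Classical in
variable (I) in
/-- `leviCivitaFun I Y x u` is `∇_u Y`: the vector with `g(∇_u Y, v)` given by the Koszul formula.
(If `Y` is not differentiable at `x`, the junk value is `0`.) -/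
def leviCivitaFun (Y : Π x : M, TangentSpace I x) (x : M) :
    TangentSpace I x →L[ℝ] TangentSpace I x :=
  have : FiniteDimensional ℝ (TangentSpace I x) := finiteDimensional_tangentSpace x
  have : CompleteSpace (TangentSpace I x) := FiniteDimensional.complete ℝ _
  if hY : MDiffAt (T% Y) x then
    LinearMap.toContinuousLinearMap
      { toFun := fun u ↦ (InnerProductSpace.toDual ℝ (TangentSpace I x)).symm
          (koszulForm I Y x hY u)
        map_add' := by simp
        map_smul' := by simp }
  else 0

/-- The Koszul formula. -/
lemma inner_leviCivitaFun (hX : MDiffAt (T% X) x) (hY : MDiffAt (T% Y) x)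
    (hZ : MDiffAt (T% Z) x) :
    inner ℝ (leviCivitaFun I Y x (X x)) (Z x) = koszul I X Y Z x := by
  rw [← koszulForm_apply hX hY hZ, leviCivitaFun, dif_pos hY]
  simp

lemma clm_ext_fields {A B : TangentSpace I x →L[ℝ] TangentSpace I x}
    (h : ∀ X Z : Π x : M, TangentSpace I x, MDiffAt (T% X) x → MDiffAt (T% Z) x →
      inner ℝ (A (X x)) (Z x) = (inner ℝ (B (X x)) (Z x) : ℝ)) : A = B := by
  ext1 u
  refine ext_inner_right ℝ fun w ↦ ?_
  simpa using h (FiberBundle.extend E u) (FiberBundle.extend E w)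
    (FiberBundle.mdifferentiableAt_extend ..) (FiberBundle.mdifferentiableAt_extend ..)

variable (I M) in
/-- The Levi-Civita connection of the Riemannian metric of `M`;
`leviCivita I M Y x u` is `∇_u Y` at the point `x`. -/
def leviCivita : CovariantDerivative I E (fun x : M ↦ TangentSpace I x) where
  toFun := leviCivitaFun I
  isCovariantDerivativeOnUniv :=
    { add := fun {Y Y' x} hY hY' _ ↦ by
        refine clm_ext_fields fun X Z hX hZ ↦ ?_
        rw [inner_leviCivitaFun hX (mdifferentiableAt_add_section hY hY') hZ,
          koszul_add hX hY hY' hZ, FunLike.coe_add, Pi.add_apply, inner_add_left,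
          inner_leviCivitaFun hX hY hZ, inner_leviCivitaFun hX hY' hZ]
      leibniz := fun {Y f x} hY hf _ ↦ by
        refine clm_ext_fields fun X Z hX hZ ↦ ?_
        rw [inner_leviCivitaFun hX (hf.smul_section hY) hZ, koszul_smul hf hX hY hZ]
        simp [inner_add_left, real_inner_smul_left, inner_leviCivitaFun hX hY hZ] }

/-- The Levi-Civita connection is torsion free. -/
theorem leviCivita_torsion_free (hX : MDiffAt (T% X) x) (hY : MDiffAt (T% Y) x) :
    leviCivita I M Y x (X x) - leviCivita I M X x (Y x) = mlieBracket I X Y x := by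
  refine ext_inner_right ℝ fun w ↦ ?_
  have hZ : MDiffAt (T% (FiberBundle.extend E w : Π x : M, TangentSpace I x)) x :=
    FiberBundle.mdifferentiableAt_extend ..
  have h1 := inner_leviCivitaFun hX hY hZ
  have h2 := inner_leviCivitaFun hY hX hZ
  rw [koszul, metricFun_comm (X := X) (Y := Y), mf_bracket_swap (X := X) (Y := Y)] at h1
  rw [koszul] at h2
  have h3 : metricFun I (mlieBracket I X Y) (FiberBundle.extend E w) x
    = - metricFun I (mlieBracket I Y X) (FiberBundle.extend E w) x := mf_bracket_swap
  simp only [metricFun_comm (X := FiberBundle.extend E w)] at h1 h2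
  have e : inner ℝ (mlieBracket I X Y x) w
    = metricFun I (mlieBracket I X Y) (FiberBundle.extend E w) x := by simp [metricFun]
  rw [FiberBundle.extend_apply_self] at h1 h2
  rw [inner_sub_left, e, h3]
  refine (congrArg₂ (· - ·) h1 h2).trans ?_
  ring

/-- The Levi-Civita connection is compatible with the metric. -/
theorem leviCivita_metric (hX : MDiffAt (T% X) x) (hY : MDiffAt (T% Y) x)
    (hZ : MDiffAt (T% Z) x) :
    mvfderiv I (fun x ↦ (inner ℝ (Y x) (Z x) : ℝ)) x (X x) =
      inner ℝ (leviCivita I M Y x (X x)) (Z x) + inner ℝ (Y x) (leviCivita I M Z x (X x)) := by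
  have h1 := inner_leviCivitaFun hX hY hZ
  have h2 := inner_leviCivitaFun hX hZ hY
  rw [real_inner_comm (leviCivita I M Z x (X x))]
  refine Eq.trans ?_ (congrArg₂ (· + ·) h1 h2).symm
  change mvfderiv I (metricFun I Y Z) x (X x) = _
  simp only [koszul]
  rw [mf_bracket_swap (X := Z) (Y := Y), mf_bracket_swap (X := Y) (Y := X),
    mf_bracket_swap (X := Z) (Y := X), metricFun_comm (X := Z) (Y := Y),
    metricFun_comm (X := Z) (Y := X), metricFun_comm (X := Y) (Y := X)]
  ring

/-! ### Vector fields, covariant derivative of an endomorphism field, curvature -/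

variable (I) in
/-- `X` is a smooth vector field on `M`. -/
def IsSmoothField (X : Π x : M, TangentSpace I x) : Prop :=
  ContMDiff I I.tangent ∞ (fun x ↦ (⟨x, X x⟩ : TangentBundle I M))

variable (I) in
/-- `φ` is a smooth tensor field of type `(1,1)` on `M`. -/
def IsSmoothEnd (φ : Π x : M, TangentSpace I x →L[ℝ] TangentSpace I x) : Prop :=
  ContMDiff I (I.prod 𝓘(ℝ, E →L[ℝ] E)) ∞ (fun x ↦ TotalSpace.mk' (E →L[ℝ] E)
    (E := fun x : M ↦ TangentSpace I x →L[ℝ] TangentSpace I x) x (φ x))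

variable (I) in
/-- `η` is a smooth 1-form on `M`. -/
def IsSmoothForm (η : Π x : M, TangentSpace I x →L[ℝ] ℝ) : Prop :=
  ContMDiff I (I.prod 𝓘(ℝ, E →L[ℝ] ℝ)) ∞ (fun x ↦ TotalSpace.mk' (E →L[ℝ] ℝ)
    (E := fun x : M ↦ TangentSpace I x →L[ℝ] ℝ) x (η x))

variable {φ : Π x : M, TangentSpace I x →L[ℝ] TangentSpace I x}

lemma IsSmoothEnd.mdifferentiableAt_apply (hφ : IsSmoothEnd I φ) (hY : MDiffAt (T% Y) x) :
    MDiffAt (T% (fun x ↦ φ x (Y x))) x :=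
  MDifferentiableAt.clm_bundle_apply (b := id) (F₁ := E) (F₂ := E)
    (hφ.mdifferentiableAt (by simp)) hY

lemma covDerivEnd_tensorial (hφ : IsSmoothEnd I φ) (x : M) :
    TensorialAt I E (fun Y ↦ leviCivita I M (fun x ↦ φ x (Y x)) x - φ x ∘L leviCivita I M Y x)
      x where
  smul {f Y} hf hY := by
    have e : (fun x ↦ φ x ((f • Y) x)) = f • fun x ↦ φ x (Y x) := by
      funext x; simp
    ext u
    simp only [e, (leviCivita I M).isCovariantDerivativeOnUniv.leibniz
      (hφ.mdifferentiableAt_apply hY) hf,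
      (leviCivita I M).isCovariantDerivativeOnUniv.leibniz hY hf]
    simp
    module
  add {Y Y'} hY hY' := by
    have e : (fun x ↦ φ x ((Y + Y') x)) = (fun x ↦ φ x (Y x)) + fun x ↦ φ x (Y' x) := by
      funext x; simp
    ext u
    simp only [e, (leviCivita I M).isCovariantDerivativeOnUniv.add
      (hφ.mdifferentiableAt_apply hY) (hφ.mdifferentiableAt_apply hY'),
      (leviCivita I M).isCovariantDerivativeOnUniv.add hY hY']
    simp
    module

/-- The covariant derivative of a smooth `(1,1)`-tensor field `φ`, as a tensor at `x`:
`covDerivEnd hφ x v u` is `(∇_u φ) v = ∇_u (φ V) - φ (∇_u V)` for any field `V` through `v`. -/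
def covDerivEnd (hφ : IsSmoothEnd I φ) (x : M) :
    TangentSpace I x →L[ℝ] TangentSpace I x →L[ℝ] TangentSpace I x :=
  TensorialAt.mkHom (I := I) (F := E)
    (fun Y ↦ leviCivita I M (fun x ↦ φ x (Y x)) x - φ x ∘L leviCivita I M Y x) x
    (covDerivEnd_tensorial hφ x)

lemma covDerivEnd_apply (hφ : IsSmoothEnd I φ) (hY : MDiffAt (T% Y) x) (u : TangentSpace I x) :
    covDerivEnd hφ x (Y x) u =
      leviCivita I M (fun x ↦ φ x (Y x)) x u - φ x (leviCivita I M Y x u) := by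
  rw [covDerivEnd, TensorialAt.mkHom_apply (covDerivEnd_tensorial hφ x) hY]
  rfl

variable (I) in
/-- The vector field `∇_X Y`. -/
def nabla (X Y : Π x : M, TangentSpace I x) : Π x : M, TangentSpace I x :=
  fun x ↦ leviCivita I M Y x (X x)

variable (I) in
/-- The curvature `R(X,Y)Z = ∇_X ∇_Y Z - ∇_Y ∇_X Z - ∇_[X,Y] Z`. -/
def curvature (X Y Z : Π x : M, TangentSpace I x) : Π x : M, TangentSpace I x :=
  nabla I X (nabla I Y Z) - nabla I Y (nabla I X Z) - nabla I (mlieBracket I X Y) Z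

variable (I) in
/-- The curvature tensor of type `(0,4)`: `R(X,Y,Z,W) = g(R(X,Y)Z, W)`. -/
def curvature₄ (X Y Z W : Π x : M, TangentSpace I x) (x : M) : ℝ :=
  inner ℝ (curvature I X Y Z x) (W x)

/-- The Ricci tensor `Ric(Y,Z) = ∑ i, R(e i, Y, Z, e i)` at `x`, computed in an orthonormal basis
`e` of the tangent space at `x`. To form `R(e i, Y)Z`, each `e i` is extended to a vector field
that is smooth near `x`. -/
def ricci {ι : Type*} [Fintype ι] {x : M} (e : OrthonormalBasis ι ℝ (TangentSpace I x))
    (Y Z : Π x : M, TangentSpace I x) : ℝ :=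
  ∑ i, curvature₄ I (FiberBundle.extend E (e i)) Y Z (FiberBundle.extend E (e i)) x

/-! ### Almost paracontact paracomplex Riemannian manifolds -/

variable (I M) in
/-- An almost paracontact paracomplex Riemannian structure `(φ, ξ, η, g)` on a manifold `M` of
dimension `2n+1`, where `g` is the given Riemannian metric of `M`. -/
structure ApcpcRStructure (n : ℕ) where
  /-- the `(1,1)`-tensor field -/
  φ : Π x : M, TangentSpace I x →L[ℝ] TangentSpace I x
  /-- the vector field -/
  ξ : Π x : M, TangentSpace I x
  /-- the 1-form -/
  η : Π x : M, TangentSpace I x →L[ℝ] ℝ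
  smooth_φ : IsSmoothEnd I φ
  smooth_ξ : IsSmoothField I ξ
  smooth_η : IsSmoothForm I η
  φ_φ : ∀ (x : M) (u : TangentSpace I x), φ x (φ x u) = u - η x u • ξ x
  η_ξ : ∀ x : M, η x (ξ x) = 1
  /-- On `ker η` the eigenvalues `1` and `-1` of `φ` both have multiplicity `n`. -/
  finrank_eigenspace_one : ∀ x : M, finrank ℝ
    ↥((η x : TangentSpace I x →ₗ[ℝ] ℝ).ker ⊓
      End.eigenspace (φ x : TangentSpace I x →ₗ[ℝ] TangentSpace I x) 1) = n
  finrank_eigenspace_neg_one : ∀ x : M, finrank ℝ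
    ↥((η x : TangentSpace I x →ₗ[ℝ] ℝ).ker ⊓
      End.eigenspace (φ x : TangentSpace I x →ₗ[ℝ] TangentSpace I x) (-1)) = n
  inner_ξ : ∀ (x : M) (u : TangentSpace I x), inner ℝ u (ξ x) = η x u
  inner_φ_φ : ∀ (x : M) (u v : TangentSpace I x),
    inner ℝ (φ x u) (φ x v) = inner ℝ u v - η x u * η x v

namespace ApcpcRStructure

variable {n : ℕ} (S : ApcpcRStructure I M n)

/-- The structure tensor `F(u,v,w) = g((∇_u φ) v, w)`. -/
def F (x : M) (u v w : TangentSpace I x) : ℝ := inner ℝ (covDerivEnd S.smooth_φ x v u) w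

/-- The vector field `φ X`. -/
def φField (X : Π x : M, TangentSpace I x) : Π x : M, TangentSpace I x := fun x ↦ S.φ x (X x)

/-- The vector field `X` is a section of the paracontact distribution `H = ker η`. -/
def IsHorizontal (X : Π x : M, TangentSpace I x) : Prop := ∀ x, S.η x (X x) = 0

/-- The structure is para-Sasaki-like: for all horizontal `u`, `v`, `w`,
`F(u,v,w) = F(ξ,v,w) = F(ξ,ξ,w) = 0` and `F(u,v,ξ) = -g(u,v)`. -/
def IsParaSasakiLike : Prop :=
  ∀ (x : M) (u v w : TangentSpace I x), S.η x u = 0 → S.η x v = 0 → S.η x w = 0 →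
    S.F x u v w = 0 ∧ S.F x (S.ξ x) v w = 0 ∧ S.F x (S.ξ x) (S.ξ x) w = 0 ∧
      S.F x u v (S.ξ x) = -inner ℝ u v

end ApcpcRStructure

end ParaSasaki

end

open ParaSasaki

/-!
The para-Sasaki-like condition says that `∇ξ = φ` (`leviCivita_ξ`) and that
`(∇_x φ)y = (2η(x)η(y) - g(x,y))ξ - η(y)x` (`covDerivEnd_eq`). Indeed `F(x,y,z) = g((∇_x φ)y, z)`
is symmetric in `y`, `z` because `φ` is self-adjoint, and `F(x,ξ,z) = -g(φ∇_x ξ, z)` because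
`φξ = 0`, so the prescribed values of `F` on `H` and `ξ` determine first `∇ξ` and then all of `∇φ`.

All the curvature identities follow by differentiating these two formulas once more.
Antisymmetrizing `∇_x(φy)` gives `R(x,y)ξ` (`curvature_ξ`), whose trace is the Ricci curvature
(`ricci_ξ`). Antisymmetrizing `∇_x∇_y(φz)` gives `R(x,y)φz - φR(x,y)z` (`curvature_φField`), since
the derivatives of `η`, `ξ` and `g` in the formula for `∇φ` are again algebraic.

The last computation differentiates the field `∇_y z`, so it needs `∇_y z` to be differentiable
(`contMDiffAt_nabla`). By the Koszul formula the functions `g(∇_y z, w)` are smooth for smooth `w`,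
and the nondegeneracy of the metric, in the form of Cramer's rule for the Gram matrix of a local
frame, passes from these functions to the field (`contMDiffAt_of_inner`).
-/

namespace ParaSasaki

/-! ### Smoothness of the Levi-Civita connection -/

section LeviCivitaSmooth

open scoped Topology

variable {E : Type*} [NormedAddCommGroup E] [NormedSpace ℝ E]
  {H : Type*} [TopologicalSpace H] {I : ModelWithCorners ℝ E H}
  {M : Type*} [TopologicalSpace M] [ChartedSpace H M] [IsManifold I ∞ M]

lemma contMDiffAt_mvfderiv_apply {f : M → ℝ} {X : Π x : M, TangentSpace I x} {p : M}
    (hf : ContMDiffAt I 𝓘(ℝ, ℝ) ∞ f p) (hX : CMDiffAt ∞ (T% X) p) :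
    ContMDiffAt I 𝓘(ℝ, ℝ) ∞ (fun q ↦ mvfderiv I f q (X q)) p := by
  have h1 : IsManifold I 1 M := .of_le (n := ∞) (by simp)
  have hd := hf.mfderiv_const (m := ∞) (by simp)
  have h := ContMDiffAt.clm_apply_of_inCoordinates hd hX hf
  exact (contMDiff_snd_tangentBundle_modelSpace ℝ 𝓘(ℝ, ℝ)).contMDiffAt.comp p h

variable [FiniteDimensional ℝ E] [RiemannianBundle (fun x : M ↦ TangentSpace I x)]
  [IsContMDiffRiemannianBundle I ∞ E (fun x : M ↦ TangentSpace I x)]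
  {X Y Z : Π x : M, TangentSpace I x} {p : M}

lemma contMDiffAt_det {m : Type*} [Fintype m] [DecidableEq m] {A : M → Matrix m m ℝ}
    (hA : ∀ i j, ContMDiffAt I 𝓘(ℝ, ℝ) ∞ (fun q ↦ A q i j) p) :
    ContMDiffAt I 𝓘(ℝ, ℝ) ∞ (fun q ↦ (A q).det) p := by
  simp only [Matrix.det_apply']
  exact contMDiffAt_finsetSum fun σ _ ↦
    contMDiffAt_const.mul (contMDiffAt_finsetProd fun i _ ↦ hA _ _)

lemma contMDiffAt_metricFun (hX : CMDiffAt ∞ (T% X) p) (hY : CMDiffAt ∞ (T% Y) p) :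
    ContMDiffAt I 𝓘(ℝ, ℝ) ∞ (metricFun I X Y) p :=
  ContMDiffAt.inner_bundle (b := id) hX hY

lemma contMDiffAt_koszul (hX : CMDiffAt ∞ (T% X) p) (hY : CMDiffAt ∞ (T% Y) p)
    (hZ : CMDiffAt ∞ (T% Z) p) : ContMDiffAt I 𝓘(ℝ, ℝ) ∞ (koszul I X Y Z) p := by
  have : CompleteSpace E := FiniteDimensional.complete ℝ E
  have hb {V W : Π x : M, TangentSpace I x} (hV : CMDiffAt ∞ (T% V) p)
      (hW : CMDiffAt ∞ (T% W) p) : CMDiffAt ∞ (T% (mlieBracket I V W)) p :=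
    haveI : IsManifold I (minSmoothness ℝ 2) M :=
      .of_le (n := ∞) (by simpa using (WithTop.coe_le_coe.2 le_top : ((2 : ℕ∞) : ℕ∞ω) ≤ ∞))
    haveI : IsManifold I (((⊤ : ℕ∞) : ℕ∞ω) + 1) M := inferInstanceAs (IsManifold I ∞ M)
    ContMDiffAt.mlieBracket_vectorField (m := ⊤) (n := ⊤) hV hW (by simp)
  exact contMDiffAt_const.mul
    ((((((contMDiffAt_mvfderiv_apply (contMDiffAt_metricFun hY hZ) hX).add
      (contMDiffAt_mvfderiv_apply (contMDiffAt_metricFun hZ hX) hY)).sub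
      (contMDiffAt_mvfderiv_apply (contMDiffAt_metricFun hX hY) hZ)).add
      (contMDiffAt_metricFun (hb hX hY) hZ)).add
      (contMDiffAt_metricFun (hb hZ hX) hY)).add
      (contMDiffAt_metricFun (hb hZ hY) hX))

/-- Nondegeneracy of the metric, in families: a vector field is smooth as soon as its inner
products with all smooth vector fields are. In a local frame, its coefficients solve a linear
system whose matrix is the (invertible) Gram matrix of the frame, so they are given by Cramer's
rule. -/
lemma contMDiffAt_of_inner {V : Π x : M, TangentSpace I x}
    (h : ∀ W : Π x : M, TangentSpace I x, CMDiffAt ∞ (T% W) p →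
      ContMDiffAt I 𝓘(ℝ, ℝ) ∞ (metricFun I V W) p) : CMDiffAt ∞ (T% V) p := by
  classical
  let e := trivializationAt E (TangentSpace I : M → Type _) p
  let b := Module.finBasis ℝ E
  let s := e.localFrame b
  have hp : p ∈ e.baseSet := mem_baseSet_trivializationAt E _ p
  have hs i : CMDiffAt ∞ (T% (s i)) p := contMDiffAt_localFrame_of_mem ∞ e b i hp
  let c := fun i q ↦ e.localFrameCoeff I b i q (V q)
  let G : M → Matrix (Fin (finrank ℝ E)) (Fin (finrank ℝ E)) ℝ :=
    fun q ↦ Matrix.of fun i j ↦ inner ℝ (s i q) (s j q)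
  have hdet : ∀ q ∈ e.baseSet, (G q).det ≠ 0 := by
    intro q hq
    have hli : LinearIndependent ℝ fun i ↦ s i q :=
      (e.isLocalFrameOn_localFrame_baseSet I ∞ b).linearIndependent hq
    exact (Matrix.posDef_gram_of_linearIndependent hli).det_pos.ne'
  have hG : ContMDiffAt I 𝓘(ℝ, ℝ) ∞ (fun q ↦ (G q).det) p :=
    contMDiffAt_det fun i j ↦ contMDiffAt_metricFun (hs i) (hs j)
  have hC i : ContMDiffAt I 𝓘(ℝ, ℝ) ∞
      (fun q ↦ ((G q).cramer fun j ↦ inner ℝ (V q) (s j q)) i) p := by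
    simp only [Matrix.cramer_apply]
    refine contMDiffAt_det fun k l ↦ ?_
    by_cases hl : l = i
    · subst hl
      simpa using! h (s k) (hs k)
    · simpa [Matrix.updateCol_apply, hl] using! contMDiffAt_metricFun (hs k) (hs l)
  have hc : ∀ q ∈ e.baseSet, ∀ i,
      c i q = ((G q).cramer fun j ↦ inner ℝ (V q) (s j q)) i / (G q).det := by
    intro q hq i
    have hV : V q = ∑ j, c j q • s j q := e.eq_sum_localFrameCoeff_smul hq
    have hlin : (G q).mulVec (fun j ↦ c j q) = fun j ↦ inner ℝ (V q) (s j q) := by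
      funext j
      rw [hV, sum_inner]
      change ∑ k, inner ℝ (s j q) (s k q) * c k q = _
      refine Finset.sum_congr rfl fun k _ ↦ ?_
      rw [real_inner_smul_left, mul_comm, real_inner_comm]
    rw [← hlin, Matrix.cramer_eq_adjugate_mulVec, Matrix.mulVec_mulVec, Matrix.adjugate_mul,
      Matrix.smul_mulVec, Matrix.one_mulVec]
    simp [hdet q hq]
  rw [contMDiffAt_iff_localFrameCoeff b hp]
  intro i
  refine ((hC i).div₀ hG (hdet p hp)).congr_of_eventuallyEq ?_
  filter_upwards [e.open_baseSet.mem_nhds hp] with q hq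
  exact hc q hq i

/-- `∇_X Y` is smooth: its inner products with smooth fields are given by the Koszul formula. Only
fields smooth near `p` are involved, so no global extension of a local frame is needed. -/
lemma contMDiffAt_nabla (hX : CMDiffAt ∞ (T% X) p) (hY : CMDiffAt ∞ (T% Y) p) :
    CMDiffAt ∞ (T% (nabla I X Y)) p := by
  have hnear {V : Π x : M, TangentSpace I x} (hV : CMDiffAt ∞ (T% V) p) :
      ∀ᶠ q in 𝓝 p, MDiffAt (T% V) q :=
    ((contMDiffAt_iff_contMDiffAt_nhds (n := 1) (by simp)).1 (hV.of_le (by simp))).mono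
      fun q hq ↦ hq.mdifferentiableAt (by simp)
  refine contMDiffAt_of_inner fun W hW ↦ (contMDiffAt_koszul hX hY hW).congr_of_eventuallyEq ?_
  filter_upwards [hnear hX, hnear hY, hnear hW] with q hXq hYq hWq
  exact inner_leviCivitaFun hXq hYq hWq

end LeviCivitaSmooth

/-! ### Curvature of para-Sasaki-like manifolds -/

section Structure

variable {E : Type*} [NormedAddCommGroup E] [NormedSpace ℝ E] [FiniteDimensional ℝ E]
  {H : Type*} [TopologicalSpace H] {I : ModelWithCorners ℝ E H}
  {M : Type*} [TopologicalSpace M] [ChartedSpace H M] [IsManifold I ∞ M]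
  [RiemannianBundle (fun x : M ↦ TangentSpace I x)]
  [IsContMDiffRiemannianBundle I ∞ E (fun x : M ↦ TangentSpace I x)]

lemma IsSmoothField.mdifferentiableAt {X : Π x : M, TangentSpace I x} (hX : IsSmoothField I X)
    (p : M) : MDiffAt (T% X) p :=
  hX.contMDiffAt.mdifferentiableAt (by simp)

namespace ApcpcRStructure

variable {n : ℕ} (S : ApcpcRStructure I M n) {X Y Z : Π x : M, TangentSpace I x} {p : M}

lemma inner_ξ_ξ (p : M) : inner ℝ (S.ξ p) (S.ξ p) = (1 : ℝ) := by rw [S.inner_ξ, S.η_ξ]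

lemma inner_ξ_left (u : TangentSpace I p) : inner ℝ (S.ξ p) u = S.η p u := by
  rw [real_inner_comm, S.inner_ξ]

lemma φ_ξ (p : M) : S.φ p (S.ξ p) = 0 := by
  have h := S.inner_φ_φ p (S.ξ p) (S.ξ p)
  rw [S.inner_ξ_ξ, S.η_ξ] at h
  exact inner_self_eq_zero.1 (h.trans (by norm_num))

lemma η_φ (u : TangentSpace I p) : S.η p (S.φ p u) = 0 := by
  -- compare `φ² (φ u)` with `φ (φ² u)`
  have h := S.φ_φ p (S.φ p u)
  rw [S.φ_φ p u, map_sub, map_smul, S.φ_ξ, smul_zero, sub_zero] at h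
  have h' := congrArg (S.η p) h
  rw [map_sub, map_smul, S.η_ξ, smul_eq_mul] at h'
  linarith

lemma inner_φ_left (u v : TangentSpace I p) :
    inner ℝ (S.φ p u) v = (inner ℝ u (S.φ p v) : ℝ) := by
  have h := S.inner_φ_φ p u (S.φ p v)
  rw [S.φ_φ, inner_sub_right, real_inner_smul_right, S.inner_ξ, S.η_φ, S.η_φ] at h
  linarith

lemma φField_apply (X : Π x : M, TangentSpace I x) (p : M) : S.φField X p = S.φ p (X p) := rfl

lemma mdifferentiableAt_φField (hX : MDiffAt (T% X) p) : MDiffAt (T% (S.φField X)) p :=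
  S.smooth_φ.mdifferentiableAt_apply hX

lemma η_field_eq (X : Π x : M, TangentSpace I x) : (fun q ↦ S.η q (X q)) = metricFun I X S.ξ := by
  funext q
  exact (S.inner_ξ q (X q)).symm

/-- The tensor `∇φ` inherits the symmetry of `φ`. -/
lemma F_symm (u v w : TangentSpace I p) : S.F p u v w = S.F p u w v := by
  have key {V W : Π x : M, TangentSpace I x} (hV : MDiffAt (T% V) p) (hW : MDiffAt (T% W) p) :
      S.F p u (V p) (W p) = S.F p u (W p) (V p) := by
    have hU : MDiffAt (T% (FiberBundle.extend E u : Π x : M, TangentSpace I x)) p :=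
      FiberBundle.mdifferentiableAt_extend ..
    have e : (fun x ↦ (inner ℝ (S.φField V x) (W x) : ℝ)) =
        fun x ↦ inner ℝ (V x) (S.φField W x) := by
      funext x
      exact S.inner_φ_left _ _
    have h1 := leviCivita_metric hU (S.mdifferentiableAt_φField hV) hW
    have h2 := leviCivita_metric hU hV (S.mdifferentiableAt_φField hW)
    rw [e, h2] at h1
    rw [FiberBundle.extend_apply_self] at h1
    simp only [F, covDerivEnd_apply S.smooth_φ hV, covDerivEnd_apply S.smooth_φ hW,
      inner_sub_left, S.inner_φ_left]
    rw [real_inner_comm (V p), real_inner_comm (S.φ p (V p))]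
    simp only [show ∀ A : Π x : M, TangentSpace I x, S.φField A = fun x ↦ S.φ x (A x)
      from fun _ ↦ rfl] at h1
    linear_combination -h1
  simpa using key (FiberBundle.mdifferentiableAt_extend I E v)
    (FiberBundle.mdifferentiableAt_extend I E w)

lemma covDerivEnd_ξ (u : TangentSpace I p) :
    covDerivEnd S.smooth_φ p (S.ξ p) u = -S.φ p (leviCivita I M S.ξ p u) := by
  have e : (fun x ↦ S.φ x (S.ξ x)) = 0 := by
    funext x
    exact S.φ_ξ x
  rw [covDerivEnd_apply S.smooth_φ (S.smooth_ξ.mdifferentiableAt p), e]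
  simp

lemma η_leviCivita_ξ (u : TangentSpace I p) : S.η p (leviCivita I M S.ξ p u) = 0 := by
  have hξ := S.smooth_ξ.mdifferentiableAt p
  have h := leviCivita_metric (X := FiberBundle.extend E u)
    (FiberBundle.mdifferentiableAt_extend ..) hξ hξ
  have e : (fun x ↦ (inner ℝ (S.ξ x) (S.ξ x) : ℝ)) = fun _ ↦ 1 := funext S.inner_ξ_ξ
  rw [e, mvfderiv_const, real_inner_comm (leviCivita I M S.ξ p _), S.inner_ξ,
    FiberBundle.extend_apply_self] at h
  simp at h
  linarith

variable {S}

/-- On a para-Sasaki-like manifold, `∇_u ξ = φ u`. -/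
lemma IsParaSasakiLike.leviCivita_ξ (hS : S.IsParaSasakiLike) (u : TangentSpace I p) :
    leviCivita I M S.ξ p u = S.φ p u := by
  -- `g(∇_u ξ, w) = g(φ ∇_u ξ, φ w) = -F(u, ξ, φ w)`
  have hF (u w : TangentSpace I p) :
      inner ℝ (leviCivita I M S.ξ p u) w = -S.F p u (S.ξ p) (S.φ p w) := by
    rw [F, S.covDerivEnd_ξ, inner_neg_left, neg_neg, S.inner_φ_φ, S.η_leviCivita_ξ]
    ring
  have hhor (u : TangentSpace I p) (hu : S.η p u = 0) : leviCivita I M S.ξ p u = S.φ p u := by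
    refine ext_inner_right ℝ fun w ↦ ?_
    rw [hF, S.F_symm, (hS p u (S.φ p w) 0 hu (S.η_φ w) (map_zero _)).2.2.2, neg_neg,
      S.inner_φ_left]
  have hξ : leviCivita I M S.ξ p (S.ξ p) = 0 := by
    refine ext_inner_right ℝ fun w ↦ ?_
    rw [hF, (hS p 0 0 (S.φ p w) (map_zero _) (map_zero _) (S.η_φ w)).2.2.1]
    simp
  have h := hhor (u - S.η p u • S.ξ p) (by simp [S.η_ξ])
  simpa [hξ, S.φ_ξ] using h

/-- On a para-Sasaki-like manifold, `∇φ` is algebraic in the structure tensors. -/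
lemma IsParaSasakiLike.covDerivEnd_eq (hS : S.IsParaSasakiLike) (u v : TangentSpace I p) :
    covDerivEnd S.smooth_φ p v u =
      (2 * S.η p u * S.η p v - inner ℝ u v) • S.ξ p - S.η p v • u := by
  refine ext_inner_right ℝ fun w ↦ ?_
  have hhor (z : TangentSpace I p) : S.η p (z - S.η p z • S.ξ p) = 0 := by simp [S.η_ξ]
  -- the components of `F` with an argument `ξ` come from `∇ξ = φ`, the other ones vanish
  have hξ (z : TangentSpace I p) : S.F p u (S.ξ p) z = S.η p u * S.η p z - inner ℝ u z := by
    rw [F, S.covDerivEnd_ξ, hS.leviCivita_ξ, S.φ_φ, inner_neg_left, inner_sub_left,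
      real_inner_smul_left, S.inner_ξ_left]
    ring
  have h0 : S.F p u (v - S.η p v • S.ξ p) (w - S.η p w • S.ξ p) = 0 := by
    obtain ⟨h1, h2, -⟩ := hS p _ _ _ (hhor u) (hhor v) (hhor w)
    simp only [F] at h1 h2 ⊢
    rw [map_sub, map_smul, inner_sub_left, real_inner_smul_left, h2, mul_zero, sub_zero] at h1
    exact h1
  have h1 : S.F p u v w = S.F p u (v - S.η p v • S.ξ p) (w - S.η p w • S.ξ p) +
      S.η p v * S.F p u (S.ξ p) w + S.η p w * S.F p u v (S.ξ p) -
      S.η p v * S.η p w * S.F p u (S.ξ p) (S.ξ p) := by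
    simp only [F, map_sub, map_smul, FunLike.coe_sub, FunLike.coe_smul, Pi.sub_apply,
      Pi.smul_apply, inner_sub_left, inner_sub_right, real_inner_smul_left, real_inner_smul_right]
    ring
  rw [h0, S.F_symm u v (S.ξ p), hξ, hξ, hξ, S.η_ξ, S.inner_ξ, F] at h1
  rw [h1, inner_sub_left, real_inner_smul_left, real_inner_smul_left, S.inner_ξ_left]
  ring

lemma IsParaSasakiLike.leviCivita_φField (hS : S.IsParaSasakiLike) (hY : MDiffAt (T% Y) p)
    (u : TangentSpace I p) :
    leviCivita I M (S.φField Y) p u = S.φ p (leviCivita I M Y p u) +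
      ((2 * S.η p u * S.η p (Y p) - inner ℝ u (Y p)) • S.ξ p - S.η p (Y p) • u) := by
  rw [← hS.covDerivEnd_eq, covDerivEnd_apply S.smooth_φ hY]
  exact (add_sub_cancel _ _).symm

/-- `R(x,y)ξ = -η(y)x + η(x)y`, obtained by differentiating `∇ξ = φ`. -/
lemma IsParaSasakiLike.curvature_ξ (hS : S.IsParaSasakiLike) (hX : MDiffAt (T% X) p)
    (hY : MDiffAt (T% Y) p) :
    curvature I X Y S.ξ p = -(S.η p (Y p) • X p) + S.η p (X p) • Y p := by
  have e (V : Π x : M, TangentSpace I x) : nabla I V S.ξ = S.φField V :=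
    funext fun q ↦ hS.leviCivita_ξ (V q)
  have ht := congrArg (S.φ p) (leviCivita_torsion_free hX hY)
  rw [map_sub] at ht
  simp only [curvature, e, Pi.sub_apply]
  rw [S.φField_apply, ← ht, nabla, nabla, hS.leviCivita_φField hX, hS.leviCivita_φField hY,
    real_inner_comm]
  module

lemma mdifferentiableAt_η (hZ : MDiffAt (T% Z) p) : MDiffAt (fun q ↦ S.η q (Z q)) p := by
  rw [S.η_field_eq]
  exact mdiff_metricFun hZ (S.smooth_ξ.mdifferentiableAt p)

/-- `(∇_x η)(z) = g(z, φ x)`, in terms of the derivative of the function `η(z)`. -/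
lemma IsParaSasakiLike.mvfderiv_η (hS : S.IsParaSasakiLike) (hX : MDiffAt (T% X) p)
    (hZ : MDiffAt (T% Z) p) :
    mvfderiv I (fun q ↦ S.η q (Z q)) p (X p) =
      S.η p (leviCivita I M Z p (X p)) + inner ℝ (Z p) (S.φ p (X p)) := by
  rw [S.η_field_eq, ← hS.leviCivita_ξ, ← S.inner_ξ]
  exact leviCivita_metric hX hZ (S.smooth_ξ.mdifferentiableAt p)

/-- The iterated covariant derivative `∇_x ∇_y (φ z)`, obtained by differentiating
`∇_y (φ z) = φ ∇_y z + (2η(y)η(z) - g(y,z))ξ - η(z)y`. -/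
lemma IsParaSasakiLike.nabla_nabla_φField (hS : S.IsParaSasakiLike) (hX : IsSmoothField I X)
    (hY : IsSmoothField I Y) (hZ : IsSmoothField I Z) (p : M) :
    nabla I X (nabla I Y (S.φField Z)) p = S.φ p (nabla I X (nabla I Y Z) p) +
      ((2 * S.η p (X p) * S.η p (nabla I Y Z p) - inner ℝ (X p) (nabla I Y Z p)) • S.ξ p
        - S.η p (nabla I Y Z p) • X p) +
      (2 * S.η p (Y p) * S.η p (Z p) - inner ℝ (Y p) (Z p)) • S.φ p (X p) +
      (2 * (S.η p (nabla I X Y p) + inner ℝ (Y p) (S.φ p (X p))) * S.η p (Z p)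
        + 2 * S.η p (Y p) * (S.η p (nabla I X Z p) + inner ℝ (Z p) (S.φ p (X p)))
        - (inner ℝ (nabla I X Y p) (Z p) + inner ℝ (Y p) (nabla I X Z p))) • S.ξ p
      - S.η p (Z p) • nabla I X Y p
      - (S.η p (nabla I X Z p) + inner ℝ (Z p) (S.φ p (X p))) • Y p := by
  have hXp := hX.mdifferentiableAt p
  have hYp := hY.mdifferentiableAt p
  have hZp := hZ.mdifferentiableAt p
  have hξp := S.smooth_ξ.mdifferentiableAt p
  have hYZ : MDiffAt (T% (nabla I Y Z)) p :=
    (contMDiffAt_nabla hY.contMDiffAt hZ.contMDiffAt).mdifferentiableAt (by simp)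
  let f₁ : M → ℝ := fun q ↦ S.η q (Y q)
  let f₂ : M → ℝ := fun q ↦ S.η q (Z q)
  let f : M → ℝ := (fun _ ↦ 2) * (f₁ * f₂) - metricFun I Y Z
  have e : nabla I Y (S.φField Z) = S.φField (nabla I Y Z) + (f • S.ξ + (-f₂) • Y) := by
    funext q
    simp only [nabla, hS.leviCivita_φField (hZ.mdifferentiableAt q), f, f₁, f₂, Pi.add_apply,
      Pi.smul_apply', φField, Pi.sub_apply, Pi.mul_apply, Pi.neg_apply, metricFun]
    module
  have hf₁ : MDiffAt f₁ p := mdifferentiableAt_η hYp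
  have hf₂ : MDiffAt f₂ p := mdifferentiableAt_η hZp
  have hc : MDiffAt (fun _ : M ↦ (2 : ℝ)) p := mdifferentiableAt_const
  have hf : MDiffAt f p := (hc.mul (hf₁.mul hf₂)).sub (mdiff_metricFun hYp hZp)
  have hdf : mvfderiv I f p (X p) =
      2 * (S.η p (nabla I X Y p) + inner ℝ (Y p) (S.φ p (X p))) * S.η p (Z p)
        + 2 * S.η p (Y p) * (S.η p (nabla I X Z p) + inner ℝ (Z p) (S.φ p (X p)))
        - (inner ℝ (nabla I X Y p) (Z p) + inner ℝ (Y p) (nabla I X Z p)) := by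
    rw [mvfderiv_sub (hc.mul (hf₁.mul hf₂)) (mdiff_metricFun hYp hZp),
      mvfderiv_mul hc (hf₁.mul hf₂), mvfderiv_mul hf₁ hf₂, mvfderiv_const]
    have h1 := hS.mvfderiv_η hXp hYp
    have h2 := hS.mvfderiv_η hXp hZp
    have h3 : mvfderiv I (metricFun I Y Z) p (X p) = _ := leviCivita_metric hXp hYp hZp
    simp only [FunLike.coe_sub, FunLike.coe_add, FunLike.coe_smul, Pi.sub_apply, Pi.add_apply,
      Pi.smul_apply, h3, f₁, f₂, h1, h2, smul_eq_mul, nabla]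
    simp
    ring
  have hcov := (leviCivita I M).isCovariantDerivativeOnUniv
  have hfξ : MDiffAt (T% (f • S.ξ)) p := hf.smul_section hξp
  have hfY : MDiffAt (T% ((-f₂) • Y)) p := hf₂.neg.smul_section hYp
  have hL : nabla I X (nabla I Y (S.φField Z)) p =
      leviCivita I M (S.φField (nabla I Y Z)) p (X p) +
      (leviCivita I M (f • S.ξ) p (X p) + leviCivita I M ((-f₂) • Y) p (X p)) := by
    rw [e, nabla]
    exact (congrArg (· (X p)) (hcov.add (S.mdifferentiableAt_φField hYZ)
      (mdifferentiableAt_add_section hfξ hfY))).trans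
      (congrArg (leviCivita I M (S.φField (nabla I Y Z)) p (X p) + ·)
        (congrArg (· (X p)) (hcov.add hfξ hfY)))
  have hLξ : leviCivita I M (f • S.ξ) p (X p) =
      f p • S.φ p (X p) + mvfderiv I f p (X p) • S.ξ p := by
    rw [← hS.leviCivita_ξ]
    exact congrArg (· (X p)) (hcov.leibniz hξp hf)
  have hLY : leviCivita I M ((-f₂) • Y) p (X p) =
      -f₂ p • nabla I X Y p + mvfderiv I (-f₂) p (X p) • Y p :=
    congrArg (· (X p)) (hcov.leibniz hYp hf₂.neg)
  rw [hL, hLξ, hLY, hS.leviCivita_φField hYZ, hdf, mvfderiv_neg, FunLike.coe_neg, Pi.neg_apply,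
    hS.mvfderiv_η hXp hZp]
  simp only [nabla, f, f₁, f₂, Pi.sub_apply, Pi.mul_apply, metricFun]
  module

/-- The Ricci identity for `φ`: the commutator of `R(x,y)` and `φ` is algebraic in the structure
tensors. -/
lemma IsParaSasakiLike.curvature_φField (hS : S.IsParaSasakiLike) (hX : IsSmoothField I X)
    (hY : IsSmoothField I Y) (hZ : IsSmoothField I Z) (p : M) :
    curvature I X Y (S.φField Z) p = S.φ p (curvature I X Y Z p)
      + (2 * S.η p (Y p) * S.η p (Z p) - inner ℝ (Y p) (Z p)) • S.φ p (X p)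
      - (2 * S.η p (X p) * S.η p (Z p) - inner ℝ (X p) (Z p)) • S.φ p (Y p)
      + (2 * S.η p (Y p) * inner ℝ (Z p) (S.φ p (X p))
        - 2 * S.η p (X p) * inner ℝ (Z p) (S.φ p (Y p))) • S.ξ p
      - (inner ℝ (Z p) (S.φ p (X p)) : ℝ) • Y p + (inner ℝ (Z p) (S.φ p (Y p)) : ℝ) • X p := by
  have ht : nabla I X Y p - nabla I Y X p = mlieBracket I X Y p :=
    leviCivita_torsion_free (hX.mdifferentiableAt p) (hY.mdifferentiableAt p)
  have hs : (inner ℝ (Y p) (S.φ p (X p)) : ℝ) = inner ℝ (X p) (S.φ p (Y p)) := by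
    rw [← S.inner_φ_left, real_inner_comm]
  simp only [curvature, Pi.sub_apply]
  rw [hS.nabla_nabla_φField hX hY hZ, hS.nabla_nabla_φField hY hX hZ,
    nabla.eq_def _ (mlieBracket I X Y) (S.φField Z), hS.leviCivita_φField (hZ.mdifferentiableAt p),
    ← ht, nabla.eq_def _ (mlieBracket I X Y) Z, ← ht, hs]
  simp only [map_sub, inner_sub_left]
  module

/-- `η(∇_ξ X) = ξ(η(X)) - g(X, φξ)`, and both terms vanish for horizontal `X`. -/
lemma IsParaSasakiLike.isHorizontal_nabla_ξ (hS : S.IsParaSasakiLike) (hX : IsSmoothField I X)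
    (hXh : S.IsHorizontal X) : S.IsHorizontal (nabla I S.ξ X) := by
  intro p
  have h := hS.mvfderiv_η (S.smooth_ξ.mdifferentiableAt p) (hX.mdifferentiableAt p)
  have e : (fun q ↦ S.η q (X q)) = fun _ ↦ 0 := funext hXh
  rw [e, mvfderiv_const, S.φ_ξ, inner_zero_right, add_zero] at h
  exact h.symm

/-- `Ric(y,ξ) = -2n η(y)`, as the trace of `R(x,y)ξ = -η(y)x + η(x)y`. -/
lemma IsParaSasakiLike.ricci_ξ (hS : S.IsParaSasakiLike)
    (e : OrthonormalBasis (Fin (2 * n + 1)) ℝ (TangentSpace I p)) (hY : MDiffAt (T% Y) p) :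
    ricci e Y S.ξ = -(2 * n) * S.η p (Y p) := by
  have h i : curvature₄ I (FiberBundle.extend E (e i)) Y S.ξ (FiberBundle.extend E (e i)) p =
      -S.η p (Y p) + inner ℝ (Y p) (e i) * inner ℝ (e i) (S.ξ p) := by
    rw [curvature₄, hS.curvature_ξ (FiberBundle.mdifferentiableAt_extend ..) hY,
      FiberBundle.extend_apply_self, inner_add_left, inner_neg_left, real_inner_smul_left,
      real_inner_smul_left, S.inner_ξ, real_inner_self_eq_norm_sq, e.norm_eq_one]
    ring
  rw [ricci, Finset.sum_congr rfl fun i _ ↦ h i, Finset.sum_add_distrib,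
    e.sum_inner_mul_inner, S.inner_ξ]
  simp
  ring

end ApcpcRStructure

end Structure

end ParaSasaki

theorem proposition3p1
    {E : Type*} [NormedAddCommGroup E] [NormedSpace ℝ E] [FiniteDimensional ℝ E]
    {H : Type*} [TopologicalSpace H] (I : ModelWithCorners ℝ E H)
    {M : Type*} [TopologicalSpace M] [ChartedSpace H M] [IsManifold I ∞ M]
    [BoundarylessManifold I M]
    [RiemannianBundle (fun x : M ↦ TangentSpace I x)]
    [IsContMDiffRiemannianBundle I ∞ E (fun x : M ↦ TangentSpace I x)]
    (n : ℕ) (hdim : finrank ℝ E = 2 * n + 1)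
    (S : ApcpcRStructure I M n) (hS : S.IsParaSasakiLike) :
    -- the formula for `R(x,y,φz,w) - R(x,y,z,φw)`
    (∀ X Y Z W : Π p : M, TangentSpace I p,
      IsSmoothField I X → IsSmoothField I Y → IsSmoothField I Z → IsSmoothField I W →
      ∀ p : M,
        curvature₄ I X Y (S.φField Z) W p - curvature₄ I X Y Z (S.φField W) p =
          - (inner ℝ (Y p) (Z p) - 2 * S.η p (Y p) * S.η p (Z p)) * inner ℝ (X p) (S.φ p (W p))
          - (inner ℝ (Y p) (W p) - 2 * S.η p (Y p) * S.η p (W p)) * inner ℝ (X p) (S.φ p (Z p))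
          + (inner ℝ (X p) (Z p) - 2 * S.η p (X p) * S.η p (Z p)) * inner ℝ (Y p) (S.φ p (W p))
          + (inner ℝ (X p) (W p) - 2 * S.η p (X p) * S.η p (W p)) * inner ℝ (Y p) (S.φ p (Z p))) ∧
    -- `R(x,y)ξ = -η(y)x + η(x)y`
    (∀ X Y : Π p : M, TangentSpace I p, IsSmoothField I X → IsSmoothField I Y →
      ∀ p : M, curvature I X Y S.ξ p = -(S.η p (Y p) • X p) + S.η p (X p) • Y p) ∧
    -- `[X,ξ] ∈ H` and `∇_ξ X = φX - [X,ξ] ∈ H`, `R(ξ,X)ξ = X` for horizontal `X`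
    (∀ X : Π p : M, TangentSpace I p, IsSmoothField I X → S.IsHorizontal X →
      S.IsHorizontal (mlieBracket I X S.ξ) ∧
      nabla I S.ξ X = S.φField X - mlieBracket I X S.ξ ∧
      S.IsHorizontal (nabla I S.ξ X) ∧
      curvature I S.ξ X S.ξ = X) ∧
    -- `Ric(y,ξ) = -2n η(y)` and `Ric(ξ,ξ) = -2n`, in any orthonormal basis of the tangent space
    (∀ (p : M) (e : OrthonormalBasis (Fin (2 * n + 1)) ℝ (TangentSpace I p)),
      (∀ Y : Π p : M, TangentSpace I p, IsSmoothField I Y →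
        ricci e Y S.ξ = -(2 * n) * S.η p (Y p)) ∧
      ricci e S.ξ S.ξ = -(2 * n)) := by
  refine ⟨fun X Y Z W hX hY hZ hW p ↦ ?_, fun X Y hX hY p ↦
    hS.curvature_ξ (hX.mdifferentiableAt p) (hY.mdifferentiableAt p), fun X hX hXh ↦ ?_,
    fun p e ↦ ⟨fun Y hY ↦ hS.ricci_ξ e (hY.mdifferentiableAt p), ?_⟩⟩
  · have hs (u v : TangentSpace I p) : (inner ℝ u (S.φ p v) : ℝ) = inner ℝ v (S.φ p u) := by
      rw [← S.inner_φ_left, real_inner_comm]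
    rw [curvature₄, curvature₄, hS.curvature_φField hX hY hZ, S.φField_apply, ← S.inner_φ_left]
    simp only [inner_add_left, inner_sub_left, real_inner_smul_left, S.inner_ξ_left,
      S.inner_φ_left, hs (Z p)]
    ring
  · have hb (p : M) : nabla I S.ξ X p = S.φField X p - mlieBracket I X S.ξ p := by
      rw [← leviCivita_torsion_free (hX.mdifferentiableAt p) (S.smooth_ξ.mdifferentiableAt p),
        hS.leviCivita_ξ]
      exact (sub_sub_cancel _ _).symm
    have hn := hS.isHorizontal_nabla_ξ hX hXh
    refine ⟨fun p ↦ ?_, funext hb, hn, funext fun p ↦ ?_⟩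
    · have h := hn p
      rw [hb, map_sub, S.φField_apply, S.η_φ] at h
      linarith
    · rw [hS.curvature_ξ (S.smooth_ξ.mdifferentiableAt p) (hX.mdifferentiableAt p), hXh, S.η_ξ]
      simp
  · rw [hS.ricci_ξ e (S.smooth_ξ.mdifferentiableAt p), S.η_ξ, mul_one]
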